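/- **Setting.** Let $(\mathcal X,d)$ be a separable metric space with its Borel $\sigma$-algebra, $P$ a probability distribution on $\mathcal X\times\{\pm1\}$ with marginal $\mu$ on $\mathcal X$, and $\eta(x)=\mathbb E(Y\mid X=x)\in[-1,1]$ any fixed version of the conditional expectation for $(X,Y)\sim P$. For measurable $S$ with $\mu(S)>0$ put $\eta(S)=\frac1{\mu(S)}\int_S\eta\,d\mu$. Let $g^*:\mathcal X\to\{\pm1\}$ be a Bayes classifier: $g^*(x)=\operatorname{sign}\eta(x)$ if $\eta(x)\ne0$, arbitrary otherwise. $B(x,r)$ is the closed ball, $\operatorname{supp}(\mu)=\{x:\mu(B(x,r))>0\ \forall r>0\}$, and $r_p(x)=\inf\{r\ge0:\mu(B(x,r))\ge p\}$. **Advantage.** For $0<p\le1$ such that some ball $B(x,r)$ has $\mu(B(x,r))\ge p$, and $\gamma>0$, the point $x$ is $(p,\gamma)$-salient if for some $s\in\{\pm1\}$: $s\,\eta(x)>0$; $s\,\eta(B(x,r))>0$ for all $r\in[0,r_p(x))$ with $\mu(B(x,r))>0$; and $s\,\eta(B(x,r_p(x)))\ge\gamma$. Put $\operatorname{adv}(x)=\sup\{p\gamma^2: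 x\text{ is }(p,\gamma)\text{-salient}\}$ if $\eta(x)\ne0$ (with $\sup\emptyset=0$), and $\operatorname{adv}(x)=0$ if $\eta(x)=0$. **AKNN classifier.** Given training points $(x_1,y_1),\dots,(x_n,y_n)$, a confidence parameter $0<\delta<1$ and a constant $c_1>0$, predict at $x$ as follows. For an integer $k$ let $B_k(x)$ be the smallest closed ball centered at $x$ that contains exactly $k$ training points (values of $k$ for which there is none are skipped), and let $\eta_n(B_k(x))$ be the average label of these points. Find the smallest $0<k\le n$ with $$|\eta_n(B_k(x))|>\Delta(n,k,\delta)=c_1\sqrt{\frac{\log n+\log(1/\delta)}{k}}$$ and predict $\operatorname{sign}\eta_n(B_k(x))$; if there is no such $k$, predict "?". **Theorem 1 (Pointwise convergence rate).** There is an absolute constant $c_0>0$ such that the following two statements hold. (a) For the AKNN classifier with $c_1=c_0$ there is an absolute constant $C>0$ such that for all $\mathcal X,P,\eta,g^*$ as above, all $0<\delta<1$, all $n$ and every $x\in\operatorname{supp}(\mu)$ with $\operatorname{adv}(x)>0$: if $$n\ \ge\ \frac{C}{\operatorname{adv}(x)}\max\Bigl(\log\frac1{\operatorname{adv}(x)},\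 \log\frac1\delta\Bigr),$$ then the classifier $g_n$ based on $n$ training points drawn i.i.d. from $P$ satisfies $g_n(x)=g^*(x)$ with probability at least $1-\delta$. (b) For every constant $c_1\ge c_0$ there is a constant $C>0$, depending only on $c_1$, such that the same holds for the AKNN classifier with this $c_1$ if $\log\frac1{\operatorname{adv}(x)}$ is replaced by $\log\frac2{\operatorname{adv}(x)}$ in the condition on $n$. -/

import Mathlib

open MeasureTheory

noncomputable section

namespace AKNN

/-! Labels are the elements of `ℤˣ = {1, -1}`. -/

/-- The label `y ∈ {±1}` as a real number. -/
def labelVal (y : ℤˣ) : ℝ := ((y : ℤ) : ℝ)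

section Distribution

variable {𝒳 : Type*} [MetricSpace 𝒳] [MeasurableSpace 𝒳]

/-- The marginal distribution `μ` on the instance space of a distribution `P` of labeled points. -/
def marginal (P : Measure (𝒳 × ℤˣ)) : Measure 𝒳 := P.map Prod.fst

/-- `η` is (an everywhere defined version of) the conditional expectation
`η(x) = E(Y | X = x) ∈ [-1, 1]`, where `(X, Y)` has distribution `P`. -/
structure IsBias (P : Measure (𝒳 × ℤˣ)) (η : 𝒳 → ℝ) : Prop where
  measurable : Measurable η
  mem_Icc : ∀ x, η x ∈ Set.Icc (-1 : ℝ) 1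
  condExp_eq : (fun z : 𝒳 × ℤˣ => η z.1) =ᵐ[P]
    P[fun z : 𝒳 × ℤˣ => labelVal z.2 | MeasurableSpace.comap Prod.fst inferInstance]

/-- The conditional expectation of `Y` given `X ∈ S`, namely `(1 / μ(S)) ∫_S η dμ`. It is
meaningful only if `μ(S) > 0`. -/
def setBias (μ : Measure 𝒳) (η : 𝒳 → ℝ) (S : Set 𝒳) : ℝ :=
  (∫ z in S, η z ∂μ) / μ.real S

/-- The probability radius `r_p(x) = inf {r ≥ 0 : μ(B(x, r)) ≥ p}`. -/
def probRadius (μ : Measure 𝒳) (x : 𝒳) (p : ℝ) : ℝ :=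
  sInf {r : ℝ | 0 ≤ r ∧ p ≤ μ.real (Metric.closedBall x r)}

/-- `x` is `(p, γ)`-salient. The third condition says that the infimum defining `r_p(x)` is over a
nonempty set (it can only fail for `p = 1`). The bias of a ball is only required to have the right
sign where it is defined, that is, where the ball has positive mass; for `x` in the support this
leaves out at most the radius `0`. -/
def Salient (μ : Measure 𝒳) (η : 𝒳 → ℝ) (x : 𝒳) (p γ : ℝ) : Prop :=
  (0 < p ∧ p ≤ 1) ∧ 0 < γ ∧ (∃ r : ℝ, 0 ≤ r ∧ p ≤ μ.real (Metric.closedBall x r)) ∧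
    ∃ s : ℝ, (s = 1 ∨ s = -1) ∧ 0 < s * η x ∧
      (∀ r : ℝ, 0 ≤ r → r < probRadius μ x p → 0 < μ.real (Metric.closedBall x r) →
        0 < s * setBias μ η (Metric.closedBall x r)) ∧
      γ ≤ s * setBias μ η (Metric.closedBall x (probRadius μ x p))

open Classical in
/-- The advantage of `x`. -/
def adv (μ : Measure 𝒳) (η : 𝒳 → ℝ) (x : 𝒳) : ℝ :=
  if η x = 0 then 0 else sSup {a : ℝ | ∃ p γ : ℝ, Salient μ η x p γ ∧ a = p * γ ^ 2}

/-- `g` is a Bayes-optimal classifier: the sign of `η`, and either label where `η` vanishes. -/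
def IsBayesClassifier (η : 𝒳 → ℝ) (g : 𝒳 → ℤˣ) : Prop :=
  ∀ x, (0 < η x → g x = 1) ∧ (η x < 0 → g x = -1)

end Distribution

section Algorithm

variable {𝒳 : Type*} [MetricSpace 𝒳] {n : ℕ}

open Classical in
/-- The indices of the training points that lie in `S`. -/
def indicesIn (T : Fin n → 𝒳 × ℤˣ) (S : Set 𝒳) : Finset (Fin n) :=
  Finset.univ.filter fun i => (T i).1 ∈ S

/-- The empirical count `#ₙ(S)`. -/
def empCount (T : Fin n → 𝒳 × ℤˣ) (S : Set 𝒳) : ℕ := (indicesIn T S).card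

/-- The empirical bias `ηₙ(S)`, meaningful if `#ₙ(S) ≠ 0`. -/
def empBias (T : Fin n → 𝒳 × ℤˣ) (S : Set 𝒳) : ℝ :=
  (∑ i ∈ indicesIn T S, labelVal (T i).2) / (empCount T S : ℝ)

/-- The radii of the balls centered at `x` that contain exactly `k` training points. -/
def radiiWith (T : Fin n → 𝒳 × ℤˣ) (x : 𝒳) (k : ℕ) : Set ℝ :=
  {r : ℝ | 0 ≤ r ∧ empCount T (Metric.closedBall x r) = k}

/-- `B_k(x)`, the smallest ball centered at `x` that contains exactly `k` training points.
It is defined only if `radiiWith T x k` is nonempty. -/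
def nnBall (T : Fin n → 𝒳 × ℤˣ) (x : 𝒳) (k : ℕ) : Set 𝒳 :=
  Metric.closedBall x (sInf (radiiWith T x k))

/-- The confidence width `Δ(n, k, δ) = c₁ √((log n + log (1/δ)) / k)`. -/
def width (c₁ : ℝ) (n k : ℕ) (δ : ℝ) : ℝ :=
  c₁ * Real.sqrt ((Real.log n + Real.log (1 / δ)) / k)

/-- `0 < k ≤ n`, the ball `B_k(x)` is defined, and it has a significant bias. -/
def Significant (c₁ δ : ℝ) (T : Fin n → 𝒳 × ℤˣ) (x : 𝒳) (k : ℕ) : Prop :=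
  0 < k ∧ k ≤ n ∧ (radiiWith T x k).Nonempty ∧ width c₁ n k δ < |empBias T (nnBall T x k)|

open Classical in
/-- The prediction at `x` of the adaptive nearest neighbor classifier, with width constant `c₁` and
confidence parameter `δ`, trained on `T`: the sign of the empirical bias of `B_k(x)` for the
smallest `k` at which it is significant, and `none` (that is, "?") if there is no such `k`. -/
def aknn (c₁ δ : ℝ) (T : Fin n → 𝒳 × ℤˣ) (x : 𝒳) : Option ℤˣ :=
  if h : ∃ k, Significant c₁ δ T x k then
    some (if 0 < empBias T (nnBall T x (Nat.find h)) then 1 else -1)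
  else none

end Algorithm

end AKNN

end

/-! Salience yields a ball B(x,R) of mass q and bias at least γ towards g = g*(x), with qγ² as close
to adv(x) as desired, such that no open ball about x of radius at most R is biased against g. Write
b = c²(log n + log(1/δ)). A set of k nearest neighbors is significant exactly when its label sum
exceeds √(bk) in absolute value. Hence the prediction is g once B(x,R) is significant towards g and
no smaller neighbor set is significant against g (`aknn_eq_some`).

The second event needs no uniform convergence theorem. Each smaller neighbor set consists of the
sample points of an open ball whose radius is the distance from x to some sample point. That point
is not in its own open ball, so given it, the other points are an i.i.d. sample and the ball is a
fixed set. A self-normalized Hoeffding bound and a union over the n points give failure probability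
n exp(-b/2). The first event fails with probability at most exp(-nqγ²/10), by a Chernoff bound valid
when b ≤ nqγ²/16. This settles the case of large n·adv(x).

In (a) the term log(1/adv(x)) can vanish, so small samples are also admitted, but only with adv(x)
and δ close to 1. Then it is likely enough that all sample points lie in the ball with label g, and
the full sample is significant if b < n. The union bound wants c² > 2, while log n ≤ n/e yields b <
n when c² < e and log(1/δ) is small; c² = 5/2 meets both. In (b), log(2/adv(x)) ≥ log 2 makes
n·adv(x) large always. -/

namespace AKNN

/-! ### Concentration of label sums under i.i.d. sampling -/

section Concentration

variable {Ω : Type*} [MeasurableSpace Ω]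

/-- The integral of a product of functions of the separate coordinates under i.i.d. sampling. -/
theorem integral_pi_prod {ι : Type*} [Fintype ι] (P : Measure Ω) [IsProbabilityMeasure P]
    (f : ι → Ω → ℝ) :
    ∫ T, ∏ j, f j (T j) ∂(Measure.pi fun _ : ι => P) = ∏ j, ∫ ω, f j ω ∂P :=
  integral_fintype_prod_eq_prod f

theorem integrable_pi_prod {ι : Type*} [Fintype ι] (P : Measure Ω) [IsProbabilityMeasure P]
    {f : ι → Ω → ℝ} (hf : ∀ j, Integrable (f j) P) :
    Integrable (fun T : ι → Ω => ∏ j, f j (T j)) (Measure.pi fun _ : ι => P) :=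
  Integrable.fintype_prod hf

theorem integrable_of_abs_le (P : Measure Ω) [IsProbabilityMeasure P] {f : Ω → ℝ}
    (hf : Measurable f) (K : ℝ) (hK : ∀ ω, |f ω| ≤ K) : Integrable f P :=
  Integrable.of_bound hf.aestronglyMeasurable K (Filter.Eventually.of_forall hK)

theorem abs_eq_one_of_sign {y : ℝ} (h : y = 1 ∨ y = -1) : |y| = 1 := by
  rcases h with h | h <;> simp [h]

/-- The moment generating function of a sign with nonnegative mean, restricted to a set. -/
theorem setIntegral_exp_neg_mul_sign_le (P : Measure Ω) [IsProbabilityMeasure P] {U : Set Ω}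
    {Y : Ω → ℝ} (hY : Measurable Y) (hY1 : ∀ ω, Y ω = 1 ∨ Y ω = -1)
    (h : 0 ≤ ∫ ω in U, Y ω ∂P) {t : ℝ} (ht : 0 ≤ t) :
    ∫ ω in U, Real.exp (-(t * Y ω)) ∂P ≤ P.real U * Real.exp (t ^ 2 / 2) := by
  have hint : Integrable Y P :=
    integrable_of_abs_le P hY 1 fun ω => (abs_eq_one_of_sign (hY1 ω)).le
  -- On ±1 the exponential is affine, so only the mean of Y over U enters, and its sign lets the
  -- sinh term be dropped.
  have hexp : ∀ ω, Real.exp (-(t * Y ω)) = Real.cosh t - Real.sinh t * Y ω := by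
    intro ω
    rcases hY1 ω with h | h
    · rw [h, mul_one, mul_one, Real.cosh_sub_sinh]
    · rw [h, mul_neg_one, neg_neg, mul_neg_one, sub_neg_eq_add, Real.cosh_add_sinh]
  simp_rw [hexp]
  rw [integral_sub (integrable_const _) (hint.integrableOn.const_mul _), integral_const_mul,
    setIntegral_const, smul_eq_mul]
  have h1 : 0 ≤ Real.sinh t * ∫ ω in U, Y ω ∂P := mul_nonneg (Real.sinh_nonneg_iff.2 ht) h
  have h2 := mul_le_mul_of_nonneg_left (Real.cosh_le_exp_half_sq t)
    (measureReal_nonneg : 0 ≤ P.real U)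
  linarith

open Classical in
/-- A self-normalized one-sided Hoeffding bound for the labels of the sample points in `U`. -/
theorem measureReal_sum_indicator_lt_neg_sqrt_le {ι : Type*} [Fintype ι] (P : Measure Ω)
    [IsProbabilityMeasure P] {U : Set Ω} (hU : MeasurableSet U)
    {Y : Ω → ℝ} (hY : Measurable Y) (hY1 : ∀ ω, Y ω = 1 ∨ Y ω = -1)
    (h : 0 ≤ ∫ ω in U, Y ω ∂P) {b : ℝ} (hb : 0 ≤ b) :
    (Measure.pi fun _ : ι => P).real
      {T | 0 < ∑ j, U.indicator (fun _ => (1 : ℝ)) (T j) ∧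
        ∑ j, U.indicator Y (T j) < -√(b * ∑ j, U.indicator (fun _ => (1 : ℝ)) (T j))} ≤
      Real.exp (-b / 2) := by
  set Q := Measure.pi fun _ : ι => P with hQ
  -- Splitting by the exact set J of indices that fall in U lets the Chernoff parameter depend on
  -- |J|. Nothing is lost in the sum over J, because the weights q^|J| (1-q)^(n-|J|) add up to 1.
  let E : Finset ι → Set (ι → Ω) := fun J =>
    {T | (∀ j, T j ∈ U ↔ j ∈ J) ∧ 0 < J.card ∧ ∑ j ∈ J, Y (T j) < -√(b * J.card)}
  have hsub : {T : ι → Ω | 0 < ∑ j, U.indicator (fun _ => (1 : ℝ)) (T j) ∧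
        ∑ j, U.indicator Y (T j) < -√(b * ∑ j, U.indicator (fun _ => (1 : ℝ)) (T j))} ⊆
      ⋃ J ∈ (Finset.univ : Finset (Finset ι)), E J := by
    intro T hT
    simp only [Set.mem_iUnion, Finset.mem_univ, exists_true_left]
    refine ⟨Finset.univ.filter fun j => T j ∈ U, ?_⟩
    simp only [Set.mem_ofPred_eq, Set.indicator_apply, ← Finset.sum_filter, Finset.sum_const,
      nsmul_eq_mul, mul_one, Nat.cast_pos] at hT
    exact ⟨fun j => by simp, hT.1, hT.2⟩
  have hE : ∀ J, Q.real (E J) ≤ (P.real U ^ J.card * (1 - P.real U) ^ (Fintype.card ι - J.card)) *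
      Real.exp (-b / 2) := by
    intro J
    have hq0 : 0 ≤ P.real U := measureReal_nonneg
    have hq1 : P.real U ≤ 1 := measureReal_le_one
    rcases Nat.eq_zero_or_pos J.card with hJ | hJ
    · have : E J = ∅ := by
        ext T; simp only [E, Set.mem_ofPred_eq, Set.mem_empty_iff_false, iff_false]; intro hT; omega
      rw [this]; simp only [measureReal_empty]
      have : 0 ≤ 1 - P.real U := by linarith
      positivity
    have hJ' : (0 : ℝ) < J.card := by exact_mod_cast hJ
    -- This t minimizes |J| t²/2 - t √(b|J|), with minimum -b/2.
    set t := √(b / J.card) with ht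
    have ht0 : 0 ≤ t := Real.sqrt_nonneg _
    have ht2 : t ^ 2 * J.card = b := by
      rw [ht, Real.sq_sqrt (by positivity)]; field_simp
    have hts : t * √(b * J.card) = b := by
      rw [ht, ← Real.sqrt_mul (by positivity)]
      rw [show b / J.card * (b * J.card) = b ^ 2 by field_simp, Real.sqrt_sq hb]
    let f : ι → Ω → ℝ := fun j => if j ∈ J then U.indicator fun ω => Real.exp (-(t * Y ω))
      else Uᶜ.indicator fun _ => 1
    have hfm : ∀ j, Integrable (f j) P := by
      intro j
      by_cases hj : j ∈ J
      · simp only [f, hj, if_true]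
        refine (integrable_of_abs_le P (by fun_prop) (Real.exp t) fun ω => ?_).indicator hU
        rw [Real.abs_exp]
        apply Real.exp_le_exp.2
        rcases hY1 ω with h | h <;> rw [h] <;> linarith
      · simp only [f, hj, if_false]
        exact (integrable_const _).indicator hU.compl
    have hf0 : ∀ j ω, 0 ≤ f j ω := by
      intro j ω
      by_cases hj : j ∈ J <;> simp only [f, hj, if_true, if_false]
      · exact Set.indicator_nonneg (fun _ _ => (Real.exp_pos _).le) _
      · exact Set.indicator_nonneg (fun _ _ => zero_le_one) _
    have hEsub : E J ⊆ {T | Real.exp b ≤ ∏ j, f j (T j)} := by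
      rintro T ⟨h1, -, h3⟩
      have h4 : ∀ j, f j (T j) = Real.exp (if j ∈ J then -(t * Y (T j)) else 0) := by
        intro j
        by_cases hj : j ∈ J
        · simp [f, hj, (h1 j).2 hj]
        · have : T j ∉ U := fun h' => hj ((h1 j).1 h')
          simp [f, hj, this]
      simp only [Set.mem_ofPred_eq, h4]
      rw [← Real.exp_sum, Real.exp_le_exp, Finset.sum_ite_mem, Finset.univ_inter,
        Finset.sum_neg_distrib, ← Finset.mul_sum]
      have := mul_le_mul_of_nonneg_left h3.le ht0
      linarith
    have hmarkov : Real.exp b * Q.real (E J) ≤ ∏ j, ∫ ω, f j ω ∂P := by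
      rw [← integral_pi_prod P f]
      refine le_trans ?_ (mul_meas_ge_le_integral_of_nonneg
        (Filter.Eventually.of_forall fun T => Finset.prod_nonneg fun j _ => hf0 j _)
        (integrable_pi_prod P hfm) (Real.exp b))
      exact mul_le_mul_of_nonneg_left (measureReal_mono hEsub) (Real.exp_pos _).le
    have hprod : ∏ j, ∫ ω, f j ω ∂P ≤ ∏ j, if j ∈ J then P.real U * Real.exp (t ^ 2 / 2)
        else (1 - P.real U) := by
      refine Finset.prod_le_prod (fun j _ => integral_nonneg (hf0 j)) fun j _ => ?_
      by_cases hj : j ∈ J <;> simp only [f, hj, if_true, if_false]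
      · rw [integral_indicator hU]
        exact setIntegral_exp_neg_mul_sign_le P hY hY1 h ht0
      · rw [integral_indicator hU.compl, setIntegral_const, smul_eq_mul, mul_one,
          probReal_compl_eq_one_sub hU]
    have hprod2 : (∏ j, if j ∈ J then P.real U * Real.exp (t ^ 2 / 2) else (1 - P.real U)) =
        (P.real U ^ J.card * (1 - P.real U) ^ (Fintype.card ι - J.card)) * Real.exp (b / 2) := by
      rw [Finset.prod_ite, Finset.prod_const, Finset.prod_const]
      have e1 : (Finset.univ.filter fun j => j ∈ J) = J := by ext; simp
      have e2 : (Finset.univ.filter fun j => j ∉ J) = Jᶜ := by ext; simp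
      rw [e1, e2, Finset.card_compl, mul_pow, ← Real.exp_nat_mul,
        show (J.card : ℝ) * (t ^ 2 / 2) = b / 2 by rw [← ht2]; ring]
      ring
    have := hmarkov.trans (hprod.trans_eq hprod2)
    rw [mul_comm, ← le_div_iff₀ (Real.exp_pos _), mul_div_assoc, ← Real.exp_sub] at this
    rwa [show b / 2 - b = -b / 2 by ring] at this
  calc _ ≤ Q.real (⋃ J ∈ (Finset.univ : Finset (Finset ι)), E J) :=
      measureReal_mono hsub (measure_ne_top _ _)
    _ ≤ ∑ J, Q.real (E J) := measureReal_biUnion_finset_le _ _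
    _ ≤ ∑ J : Finset ι, (P.real U ^ J.card * (1 - P.real U) ^ (Fintype.card ι - J.card)) *
          Real.exp (-b / 2) := Finset.sum_le_sum fun J _ => hE J
    _ = Real.exp (-b / 2) := by
      rw [← Finset.sum_mul, Fintype.sum_pow_mul_eq_add_pow]; simp

/-- A sample puts enough positively labeled points into a set of positive bias. -/
theorem measureReal_sum_indicator_le_sqrt_le {ι : Type*} [Fintype ι] (P : Measure Ω)
    [IsProbabilityMeasure P] {U : Set Ω} (hU : MeasurableSet U)
    {Y : Ω → ℝ} (hY : Measurable Y) (hY1 : ∀ ω, Y ω = 1 ∨ Y ω = -1)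
    {γ : ℝ} (hγ : 0 < γ) (hγ1 : γ ≤ 1) (h : γ * P.real U ≤ ∫ ω in U, Y ω ∂P) {b : ℝ}
    (hb : b ≤ Fintype.card ι * P.real U * γ ^ 2 / 16) :
    (Measure.pi fun _ : ι => P).real
      {T | ∑ j, U.indicator Y (T j) ≤ √(b * ∑ j, U.indicator (fun _ => (1 : ℝ)) (T j))} ≤
      Real.exp (-(Fintype.card ι * P.real U * γ ^ 2) / 10) := by
  set Q := Measure.pi fun _ : ι => P with hQ
  set q := P.real U with hq
  have hq0 : 0 ≤ q := measureReal_nonneg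
  have hYint : Integrable Y P :=
    integrable_of_abs_le P hY 1 fun ω => (abs_eq_one_of_sign (hY1 ω)).le
  -- Chernoff with parameter γ/3; the correction γ/8 per point of U absorbs the random count in the
  -- threshold.
  set f : Ω → ℝ := fun ω => Real.exp (-(γ / 3 * (U.indicator Y ω -
    γ / 8 * U.indicator (fun _ => (1 : ℝ)) ω))) with hf
  have hind : ∀ ω, |U.indicator Y ω - γ / 8 * U.indicator (fun _ => (1 : ℝ)) ω| ≤
      9 / 8 * U.indicator (fun _ => (1 : ℝ)) ω := by
    intro ω
    by_cases hω : ω ∈ U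
    · simp only [Set.indicator_of_mem hω]
      rcases hY1 ω with h | h <;> rw [h, abs_le] <;> constructor <;> linarith
    · simp [Set.indicator_of_notMem hω]
  have hind1 : ∀ ω, 0 ≤ U.indicator (fun _ => (1 : ℝ)) ω ∧
      U.indicator (fun _ => (1 : ℝ)) ω ≤ 1 ∧
      U.indicator (fun _ => (1 : ℝ)) ω ^ 2 = U.indicator (fun _ => (1 : ℝ)) ω := by
    intro ω
    by_cases hω : ω ∈ U <;> simp [hω]
  have hYm : Measurable (U.indicator Y) := hY.indicator hU
  have h1m : Measurable (U.indicator fun _ => (1 : ℝ)) := measurable_const.indicator hU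
  have hsmall : ∀ ω, |-(γ / 3 * (U.indicator Y ω - γ / 8 * U.indicator (fun _ => (1 : ℝ)) ω))| ≤
      1 := by
    intro ω
    rw [abs_neg, abs_mul, abs_of_pos (by positivity)]
    have h1 := hind ω
    have h2 := (hind1 ω).2.1
    have h3 := abs_nonneg (U.indicator Y ω - γ / 8 * U.indicator (fun _ => (1 : ℝ)) ω)
    nlinarith
  -- exp u ≤ 1 + u + u² for |u| ≤ 1; here u² ≤ (γ²/9)(81/64) on U.
  have hfle : ∀ ω, f ω ≤ 1 - γ / 3 * U.indicator Y ω +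
      (γ ^ 2 / 24 + γ ^ 2 * (9 / 64)) * U.indicator (fun _ => (1 : ℝ)) ω := by
    intro ω
    have h1 := (abs_le.1 (Real.abs_exp_sub_one_sub_id_le (hsmall ω))).2
    have h2 : (U.indicator Y ω - γ / 8 * U.indicator (fun _ => (1 : ℝ)) ω) ^ 2 ≤
        81 / 64 * U.indicator (fun _ => (1 : ℝ)) ω := by
      rw [← sq_abs]
      have := pow_le_pow_left₀ (abs_nonneg _) (hind ω) 2
      rw [mul_pow, (hind1 ω).2.2] at this
      linarith
    have h3 := mul_le_mul_of_nonneg_left h2 (by positivity : 0 ≤ γ ^ 2 / 9)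
    simp only [hf]
    nlinarith
  have hfi : Integrable f P := by
    refine integrable_of_abs_le P (by fun_prop) (Real.exp 1) fun ω => ?_
    rw [hf, Real.abs_exp]
    exact Real.exp_le_exp.2 ((le_abs_self _).trans (hsmall ω))
  -- The coefficient is 1/3 - 1/24 - 9/64 = 29/192.
  have hE : ∫ ω, f ω ∂P ≤ Real.exp (-(29 / 192) * (q * γ ^ 2)) := by
    have i1 : Integrable (U.indicator Y) P := hYint.indicator hU
    have i2 : Integrable (U.indicator fun _ => (1 : ℝ)) P := (integrable_const _).indicator hU
    have i3 : Integrable (fun ω => 1 - γ / 3 * U.indicator Y ω) P :=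
      (integrable_const 1).sub (i1.const_mul (γ / 3))
    refine (integral_mono hfi (i3.add
      (i2.const_mul (γ ^ 2 / 24 + γ ^ 2 * (9 / 64)))) hfle).trans ?_
    change ∫ ω, (1 - γ / 3 * U.indicator Y ω) +
      (γ ^ 2 / 24 + γ ^ 2 * (9 / 64)) * U.indicator (fun _ => (1 : ℝ)) ω ∂P ≤ _
    rw [integral_add i3 (i2.const_mul _),
      integral_sub (integrable_const 1) (i1.const_mul _), integral_const_mul, integral_const_mul,
      integral_indicator hU, integral_indicator hU, setIntegral_const]
    simp only [integral_const, probReal_univ, smul_eq_mul, mul_one]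
    have h1 := Real.add_one_le_exp (-(29 / 192) * (q * γ ^ 2))
    have h2 := mul_le_mul_of_nonneg_left h (by positivity : 0 ≤ γ / 3)
    rw [← hq]
    nlinarith
  have hsub : {T : ι → Ω | ∑ j, U.indicator Y (T j) ≤
      √(b * ∑ j, U.indicator (fun _ => (1 : ℝ)) (T j))} ⊆
      {T | Real.exp (-(Fintype.card ι * q * γ ^ 2) / 24) ≤ ∏ j, f (T j)} := by
    intro T hT
    simp only [Set.mem_ofPred_eq] at hT ⊢
    set N := ∑ j, U.indicator (fun _ => (1 : ℝ)) (T j) with hN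
    set S := ∑ j, U.indicator Y (T j) with hS
    have hN0 : 0 ≤ N := Finset.sum_nonneg fun j _ => (hind1 _).1
    -- AM-GM: bN ≤ (γ²/16)(nq)N ≤ (γ/8)² (nq + N)².
    have h1 : √(b * N) ≤ γ / 8 * (Fintype.card ι * q + N) := by
      apply Real.sqrt_le_iff.2
      have hc : (0 : ℝ) ≤ Fintype.card ι := Nat.cast_nonneg _
      refine ⟨by positivity, (mul_le_mul_of_nonneg_right hb hN0).trans ?_⟩
      nlinarith [mul_nonneg (sq_nonneg γ) (sq_nonneg (Fintype.card ι * q - N))]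
    simp only [hf]
    rw [← Real.exp_sum, Real.exp_le_exp, Finset.sum_neg_distrib, ← Finset.mul_sum,
      Finset.sum_sub_distrib, ← Finset.mul_sum, ← hN, ← hS]
    have h2 : S - γ / 8 * N ≤ γ / 8 * (Fintype.card ι * q) := by linarith
    have h3 := mul_le_mul_of_nonneg_left h2 (by positivity : 0 ≤ γ / 3)
    linarith
  have hmarkov : Real.exp (-(Fintype.card ι * q * γ ^ 2) / 24) * Q.real {T : ι → Ω |
      ∑ j, U.indicator Y (T j) ≤ √(b * ∑ j, U.indicator (fun _ => (1 : ℝ)) (T j))} ≤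
      Real.exp (-(29 / 192) * (q * γ ^ 2)) ^ Fintype.card ι := by
    calc _ ≤ Real.exp (-(Fintype.card ι * q * γ ^ 2) / 24) *
          Q.real {T | Real.exp (-(Fintype.card ι * q * γ ^ 2) / 24) ≤ ∏ j, f (T j)} :=
          mul_le_mul_of_nonneg_left (measureReal_mono hsub) (Real.exp_pos _).le
      _ ≤ ∫ T, ∏ j, f (T j) ∂Q := mul_meas_ge_le_integral_of_nonneg
        (Filter.Eventually.of_forall fun T => Finset.prod_nonneg fun j _ => (Real.exp_pos _).le)
        (integrable_pi_prod P fun _ => hfi) _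
      _ = (∫ ω, f ω ∂P) ^ Fintype.card ι := by
        rw [integral_pi_prod P fun _ => f]; simp
      _ ≤ _ := pow_le_pow_left₀ (integral_nonneg fun ω => (Real.exp_pos _).le) hE _
  rw [← Real.exp_nat_mul, mul_comm, ← le_div_iff₀ (Real.exp_pos _), ← Real.exp_sub] at hmarkov
  -- 29/192 - 1/24 = 7/64, which exceeds 1/10.
  refine hmarkov.trans (Real.exp_le_exp.2 ?_)
  have : 0 ≤ Fintype.card ι * q * γ ^ 2 := by positivity
  linarith

/-- Leave-one-out form of the self-normalized bound: the set is a sublevel set of `ρ` whose level is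
the value of `ρ` at a sample point. -/
theorem measureReal_leaveOneOut_le {n : ℕ} (P : Measure Ω) [IsProbabilityMeasure P]
    {ρ : Ω → ℝ} (hρ : Measurable ρ) {Y : Ω → ℝ} (hY : Measurable Y)
    (hY1 : ∀ ω, Y ω = 1 ∨ Y ω = -1) {R : ℝ}
    (h : ∀ d ≤ R, 0 ≤ ∫ ω in {ω | ρ ω < d}, Y ω ∂P) {b : ℝ} (hb : 0 ≤ b) (i : Fin n) :
    (Measure.pi fun _ : Fin n => P).real
      {T | ρ (T i) ≤ R ∧ 0 < ∑ j, {ω | ρ ω < ρ (T i)}.indicator (fun _ => (1 : ℝ)) (T j) ∧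
        ∑ j, {ω | ρ ω < ρ (T i)}.indicator Y (T j) <
          -√(b * ∑ j, {ω | ρ ω < ρ (T i)}.indicator (fun _ => (1 : ℝ)) (T j))} ≤
      Real.exp (-b / 2) := by
  obtain _ | m := n
  · exact i.elim0
  set A : Set (Fin (m + 1) → Ω) :=
    {T | ρ (T i) ≤ R ∧ 0 < ∑ j, {ω | ρ ω < ρ (T i)}.indicator (fun _ => (1 : ℝ)) (T j) ∧
        ∑ j, {ω | ρ ω < ρ (T i)}.indicator Y (T j) <
          -√(b * ∑ j, {ω | ρ ω < ρ (T i)}.indicator (fun _ => (1 : ℝ)) (T j))} with hA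
  let D : Set (Ω × (Fin m → Ω)) :=
    {z | ρ z.1 ≤ R ∧ 0 < ∑ j, {ω | ρ ω < ρ z.1}.indicator (fun _ => (1 : ℝ)) (z.2 j) ∧
        ∑ j, {ω | ρ ω < ρ z.1}.indicator Y (z.2 j) <
          -√(b * ∑ j, {ω | ρ ω < ρ z.1}.indicator (fun _ => (1 : ℝ)) (z.2 j))}
  have hmeas : ∀ {g : Ω → ℝ}, Measurable g → Measurable fun z : Ω × (Fin m → Ω) =>
      ∑ j, {ω | ρ ω < ρ z.1}.indicator g (z.2 j) := by
    intro g hg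
    refine Finset.measurable_sum _ fun j _ => ?_
    simp only [Set.indicator_apply, Set.mem_ofPred_eq]
    exact Measurable.ite (measurableSet_lt (hρ.comp ((measurable_pi_apply j).comp measurable_snd))
      (hρ.comp measurable_fst)) (hg.comp ((measurable_pi_apply j).comp measurable_snd))
      measurable_const
  have hD : MeasurableSet D := by
    have h1 := hmeas (measurable_const (a := (1 : ℝ)))
    have h2 := hmeas hY
    exact (measurableSet_le (hρ.comp measurable_fst) measurable_const).inter
      ((measurableSet_lt measurable_const h1).inter
        (measurableSet_lt h2 (h1.const_mul b).sqrt.neg))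
  -- The strict inequality in the sublevel set makes the term of index i vanish, so the event
  -- depends on the i-th point only through the level. Fubini then freezes that point and applies
  -- the fixed-set bound to the remaining m.
  have hpre : A = (MeasurableEquiv.piFinSuccAbove (fun _ : Fin (m + 1) => Ω) i) ⁻¹' D := by
    ext T
    simp only [hA, D, Set.mem_ofPred_eq, Set.mem_preimage, Fin.sum_univ_succAbove _ i,
      MeasurableEquiv.piFinSuccAbove_apply, Fin.insertNthEquiv_symm_apply, Fin.removeNth]
    simp [Set.indicator_apply]
  have hle : (Measure.pi fun _ : Fin (m + 1) => P) A ≤ ENNReal.ofReal (Real.exp (-b / 2)) := by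
    rw [hpre, (measurePreserving_piFinSuccAbove (fun _ : Fin (m + 1) => P) i).measure_preimage
      hD.nullMeasurableSet, Measure.prod_apply hD]
    calc _ ≤ ∫⁻ _, ENNReal.ofReal (Real.exp (-b / 2)) ∂P := by
          refine lintegral_mono fun z => ?_
          rw [← ENNReal.ofReal_toReal (measure_ne_top _ (Prod.mk z ⁻¹' D))]
          apply ENNReal.ofReal_le_ofReal
          by_cases hz : ρ z ≤ R
          · refine le_trans ?_ (measureReal_sum_indicator_lt_neg_sqrt_le (ι := Fin m) P
              (U := {ω | ρ ω < ρ z}) (measurableSet_lt hρ measurable_const) hY hY1 (h _ hz) hb)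
            exact measureReal_mono fun T hT => hT.2
          · have : Prod.mk z ⁻¹' D = ∅ := by
              ext T; simp [D, hz]
            rw [this]; simp [(Real.exp_pos _).le]
      _ = _ := by simp
  exact ENNReal.toReal_le_of_le_ofReal (Real.exp_pos _).le hle

end Concentration

/-! ### Deterministic analysis of the classifier -/

section Deterministic

theorem mem_indicesIn {𝒳 : Type*} {n : ℕ} {T : Fin n → 𝒳 × ℤˣ} {S : Set 𝒳} {i : Fin n} :
    i ∈ indicesIn T S ↔ (T i).1 ∈ S := by
  simp [indicesIn]

variable {𝒳 : Type*} [MetricSpace 𝒳] {n : ℕ}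

theorem indicesIn_mono {𝒳 : Type*} {n : ℕ} (T : Fin n → 𝒳 × ℤˣ) {S S' : Set 𝒳} (h : S ⊆ S') :
    indicesIn T S ⊆ indicesIn T S' := fun _ hi =>
  mem_indicesIn.2 (h (mem_indicesIn.1 hi))

/-- The ball `B_k(x)` has the same training points as every ball with `k` training points. -/
theorem indicesIn_nnBall (T : Fin n → 𝒳 × ℤˣ) (x : 𝒳) {k : ℕ} {r : ℝ} (hr : r ∈ radiiWith T x k) :
    indicesIn T (nnBall T x k) = indicesIn T (Metric.closedBall x r) := by
  have hbdd : BddBelow (radiiWith T x k) := ⟨0, fun _ h => h.1⟩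
  refine subset_antisymm (indicesIn_mono T (Metric.closedBall_subset_closedBall
    (csInf_le hbdd hr))) fun j hj => ?_
  by_contra hj'
  rw [mem_indicesIn, nnBall, Metric.mem_closedBall, not_le] at hj'
  -- A ball of radius r' has the same count and lies inside the ball of radius r, so it holds the
  -- same points; yet it misses j.
  obtain ⟨r', hr', hlt⟩ := exists_lt_of_csInf_lt ⟨r, hr⟩ hj'
  have hjr := Metric.mem_closedBall.1 (mem_indicesIn.1 hj)
  have heq := Finset.eq_of_subset_of_card_le (indicesIn_mono T
    (Metric.closedBall_subset_closedBall (hlt.le.trans hjr)))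
    (show (indicesIn T (Metric.closedBall x r)).card ≤ _ from (hr.2.trans hr'.2.symm).le)
  rw [← heq, mem_indicesIn, Metric.mem_closedBall] at hj
  linarith

theorem empBias_nnBall (T : Fin n → 𝒳 × ℤˣ) (x : 𝒳) {k : ℕ} {r : ℝ} (hr : r ∈ radiiWith T x k) :
    empBias T (nnBall T x k) =
      (∑ i ∈ indicesIn T (Metric.closedBall x r), labelVal (T i).2) / k := by
  rw [empBias, empCount, indicesIn_nnBall T x hr,
    show (indicesIn T (Metric.closedBall x r)).card = k from hr.2]

theorem width_mul (c : ℝ) (hc : 0 ≤ c) (n : ℕ) {k : ℕ} (hk : 0 < k) (δ : ℝ) :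
    width c n k δ * k = √(c ^ 2 * (Real.log n + Real.log (1 / δ)) * k) := by
  have hk' : (0 : ℝ) < k := by exact_mod_cast hk
  have e : c ^ 2 * (Real.log n + Real.log (1 / δ)) * k =
      (c * k) ^ 2 * ((Real.log n + Real.log (1 / δ)) / k) := by field_simp
  rw [width, e, Real.sqrt_mul (by positivity), Real.sqrt_sq (by positivity)]
  ring

/-- The classifier is right if the ball of radius `R` is significant with label `g`, and no smaller
set of nearest neighbors is significant with the opposite label. -/
theorem aknn_eq_some {c δ : ℝ} (hc : 0 ≤ c) (T : Fin n → 𝒳 × ℤˣ) (x : 𝒳) (g : ℤˣ)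
    {R : ℝ} (hR : 0 ≤ R)
    (h1 : √(c ^ 2 * (Real.log n + Real.log (1 / δ)) * empCount T (Metric.closedBall x R)) <
      ∑ i ∈ indicesIn T (Metric.closedBall x R), labelVal g * labelVal (T i).2)
    (h2 : ∀ i, dist (T i).1 x ≤ R → 0 < empCount T (Metric.ball x (dist (T i).1 x)) →
      -√(c ^ 2 * (Real.log n + Real.log (1 / δ)) * empCount T (Metric.ball x (dist (T i).1 x))) ≤
        ∑ j ∈ indicesIn T (Metric.ball x (dist (T i).1 x)), labelVal g * labelVal (T j).2) :
    aknn c δ T x = some g := by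
  set K := empCount T (Metric.closedBall x R) with hK
  have hKpos : 0 < K := by
    by_contra h0
    have h0 : (indicesIn T (Metric.closedBall x R)).card = 0 := by
      simpa [empCount, hK] using h0
    rw [Finset.card_eq_zero.1 h0, Finset.sum_empty] at h1
    exact absurd h1 (not_lt.2 (Real.sqrt_nonneg _))
  have hg : labelVal g = 1 ∧ g = 1 ∨ labelVal g = -1 ∧ g = -1 := by
    rcases Int.units_eq_one_or g with rfl | rfl <;> simp [labelVal]
  have hgabs : |labelVal g| = 1 := by rcases hg with h | h <;> simp [h.1]
  have hRmem : R ∈ radiiWith T x K := ⟨hR, rfl⟩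
  have hsigK : Significant c δ T x K := by
    refine ⟨hKpos, ?_, ⟨R, hRmem⟩, ?_⟩
    · simpa [empCount, hK] using Finset.card_le_univ (indicesIn T (Metric.closedBall x R))
    · have hK' : (0 : ℝ) < K := by exact_mod_cast hKpos
      rw [empBias_nnBall T x hRmem, abs_div, abs_of_pos hK', lt_div_iff₀ hK', width_mul c hc n hKpos]
      refine h1.trans_le ?_
      rw [← Finset.mul_sum]
      refine (le_abs_self _).trans ?_
      rw [abs_mul, hgabs, one_mul]
  have hex : ∃ k, Significant c δ T x k := ⟨K, hsigK⟩
  classical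
  rw [aknn, dif_pos hex]
  have hle : Nat.find hex ≤ K := Nat.find_min' hex hsigK
  have hsig := Nat.find_spec hex
  set k := Nat.find hex with hk
  obtain ⟨hkpos, -, ⟨r, hr⟩, hw⟩ := hsig
  have hk' : (0 : ℝ) < k := by exact_mod_cast hkpos
  -- The neighbor set chosen by the algorithm is not significant against g; being significant, it
  -- must therefore favor g.
  have key : -√(c ^ 2 * (Real.log n + Real.log (1 / δ)) * k) ≤
      ∑ i ∈ indicesIn T (Metric.closedBall x r), labelVal g * labelVal (T i).2 := by
    rcases hle.eq_or_lt with heq | hlt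
    · rw [← indicesIn_nnBall T x hr, heq, indicesIn_nnBall T x hRmem]
      linarith [Real.sqrt_nonneg (c ^ 2 * (Real.log n + Real.log (1 / δ)) * K)]
    · have hrR : r < R := by
        by_contra hcon
        have := Finset.card_le_card (indicesIn_mono T
          (Metric.closedBall_subset_closedBall (x := x) (not_lt.1 hcon)))
        have hr2 : (indicesIn T (Metric.closedBall x r)).card = k := hr.2
        have : K ≤ k := hr2 ▸ this
        omega
      have hne : ((indicesIn T (Metric.closedBall x R)) \
          indicesIn T (Metric.closedBall x r)).Nonempty := by
        rw [Finset.sdiff_nonempty]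
        intro hcon
        have := Finset.card_le_card hcon
        have hr2 : (indicesIn T (Metric.closedBall x r)).card = k := hr.2
        have : K ≤ k := hr2 ▸ this
        omega
      -- The nearest sample point beyond radius r: its open ball holds exactly the chosen k points,
      -- even when distances tie.
      obtain ⟨i, hi, hmin⟩ := Finset.exists_min_image _ (fun i => dist (T i).1 x) hne
      simp only [Finset.mem_sdiff, mem_indicesIn, Metric.mem_closedBall, not_le] at hi hmin
      have hset : indicesIn T (Metric.ball x (dist (T i).1 x)) =
          indicesIn T (Metric.closedBall x r) := by
        ext j
        simp only [mem_indicesIn, Metric.mem_ball, Metric.mem_closedBall]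
        refine ⟨fun hj => ?_, fun hj => hj.trans_lt hi.2⟩
        by_contra hcon
        exact absurd (hmin j ⟨hj.le.trans hi.1, not_le.1 hcon⟩) (not_le.2 hj)
      have hcount : empCount T (Metric.ball x (dist (T i).1 x)) = k := by
        rw [empCount, hset]; exact hr.2
      have := h2 i hi.1 (hcount ▸ hkpos)
      rwa [hcount, hset] at this
  rw [empBias_nnBall T x hr] at hw ⊢
  rw [abs_div, abs_of_pos hk', lt_div_iff₀ hk', width_mul c hc n hkpos] at hw
  rw [← Finset.mul_sum] at key
  set S := ∑ i ∈ indicesIn T (Metric.closedBall x r), labelVal (T i).2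
  have hs0 := Real.sqrt_nonneg (c ^ 2 * (Real.log n + Real.log (1 / δ)) * k)
  rcases hg with ⟨e, rfl⟩ | ⟨e, rfl⟩
  · rw [e, one_mul] at key
    rw [if_pos]
    apply div_pos _ hk'
    rcases lt_abs.1 hw with h | h <;> linarith
  · rw [e, neg_one_mul] at key
    rw [if_neg]
    rw [not_lt]
    apply div_nonpos_of_nonpos_of_nonneg _ hk'.le
    rcases lt_abs.1 hw with h | h <;> linarith

end Deterministic

/-! ### Labels, marginal and conditional expectation -/

section Labels

variable {𝒳 : Type*} [MeasurableSpace 𝒳]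

theorem labelVal_eq (y : ℤˣ) : labelVal y = 1 ∨ labelVal y = -1 := by
  rcases Int.units_eq_one_or y with rfl | rfl <;> simp [labelVal]

theorem measurable_labelVal : Measurable labelVal :=
  (measurable_from_top (f := fun k : ℤ => (k : ℝ))).comp (comap_measurable Units.val)

theorem integrable_labelVal (P : Measure (𝒳 × ℤˣ)) [IsProbabilityMeasure P] :
    Integrable (fun z : 𝒳 × ℤˣ => labelVal z.2) P :=
  integrable_of_abs_le P (measurable_labelVal.comp measurable_snd) 1 fun z =>
    (abs_eq_one_of_sign (labelVal_eq z.2)).le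

instance isProbabilityMeasure_marginal (P : Measure (𝒳 × ℤˣ)) [IsProbabilityMeasure P] :
    IsProbabilityMeasure (marginal P) :=
  Measure.isProbabilityMeasure_map measurable_fst.aemeasurable

theorem marginal_real_apply (P : Measure (𝒳 × ℤˣ)) {S : Set 𝒳} (hS : MeasurableSet S) :
    (marginal P).real S = P.real (Prod.fst ⁻¹' S) := by
  rw [measureReal_def, measureReal_def, marginal, Measure.map_apply measurable_fst hS]

/-- The bias integrates over a set to the expected label there. -/
theorem IsBias.setIntegral_eq {P : Measure (𝒳 × ℤˣ)} [IsProbabilityMeasure P] {η : 𝒳 → ℝ}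
    (hη : IsBias P η) {S : Set 𝒳} (hS : MeasurableSet S) :
    ∫ z in Prod.fst ⁻¹' S, labelVal z.2 ∂P = ∫ x in S, η x ∂(marginal P) := by
  rw [marginal, setIntegral_map hS hη.measurable.aestronglyMeasurable
    measurable_fst.aemeasurable]
  have hm : MeasurableSpace.comap (Prod.fst : 𝒳 × ℤˣ → 𝒳) inferInstance ≤
      (inferInstance : MeasurableSpace (𝒳 × ℤˣ)) := measurable_fst.comap_le
  rw [← setIntegral_condExp hm (integrable_labelVal P) ⟨S, hS, rfl⟩]
  exact integral_congr_ae (ae_restrict_of_ae hη.condExp_eq.symm)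

theorem IsBias.integrable {P : Measure (𝒳 × ℤˣ)} [IsProbabilityMeasure P] {η : 𝒳 → ℝ}
    (hη : IsBias P η) : Integrable η (marginal P) :=
  integrable_of_abs_le _ hη.measurable 1 fun x => abs_le.2 (hη.mem_Icc x)

end Labels

/-! ### Bias of balls under the population measure -/

section Population

variable {𝒳 : Type*} [MetricSpace 𝒳] [MeasurableSpace 𝒳] [BorelSpace 𝒳]

/-- The infimum in the definition of the probability radius is attained. -/
theorem le_measureReal_closedBall_probRadius (μ : Measure 𝒳) [IsFiniteMeasure μ] (x : 𝒳) {p : ℝ}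
    (h : ∃ r : ℝ, 0 ≤ r ∧ p ≤ μ.real (Metric.closedBall x r)) :
    p ≤ μ.real (Metric.closedBall x (probRadius μ x p)) := by
  set R := probRadius μ x p with hR
  have hk : ∀ k : ℕ, p ≤ μ.real (Metric.closedBall x (R + 1 / ((k : ℝ) + 1))) := by
    intro k
    have : R < R + 1 / ((k : ℝ) + 1) := by
      have : 0 < 1 / ((k : ℝ) + 1) := by positivity
      linarith
    obtain ⟨r, hr, hlt⟩ := exists_lt_of_csInf_lt h this
    exact hr.2.trans (measureReal_mono (Metric.closedBall_subset_closedBall hlt.le))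
  have hanti : Antitone fun k : ℕ => Metric.closedBall x (R + 1 / ((k : ℝ) + 1)) := by
    intro i j hij
    apply Metric.closedBall_subset_closedBall
    have := Nat.one_div_le_one_div (α := ℝ) hij
    linarith
  have hlim := tendsto_measure_iInter_atTop (μ := μ)
    (fun k : ℕ => (Metric.isClosed_closedBall.measurableSet : MeasurableSet
      (Metric.closedBall x (R + 1 / ((k : ℝ) + 1)))).nullMeasurableSet) hanti
    ⟨0, measure_ne_top _ _⟩
  have hinter : ⋂ k : ℕ, Metric.closedBall x (R + 1 / ((k : ℝ) + 1)) = Metric.closedBall x R := by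
    ext y
    simp only [Set.mem_iInter, Metric.mem_closedBall]
    refine ⟨fun hy => ?_, fun hy k => hy.trans ?_⟩
    · have := tendsto_one_div_add_atTop_nhds_zero_nat (𝕜 := ℝ).const_add R
      rw [add_zero] at this
      exact ge_of_tendsto' this hy
    · have : 0 < 1 / ((k : ℝ) + 1) := by positivity
      linarith
  rw [hinter] at hlim
  exact ge_of_tendsto' ((ENNReal.tendsto_toReal (measure_ne_top _ _)).comp hlim) hk

/-- Up to the probability radius, open balls have no bias of the wrong sign. -/
theorem setIntegral_ball_nonneg {μ : Measure 𝒳} [IsFiniteMeasure μ] {η : 𝒳 → ℝ}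
    (hη : Integrable η μ) {x : 𝒳} {s R : ℝ}
    (h : ∀ r : ℝ, 0 ≤ r → r < R → 0 < μ.real (Metric.closedBall x r) →
        0 < s * setBias μ η (Metric.closedBall x r)) {d : ℝ} (hd : d ≤ R) :
    0 ≤ s * ∫ z in Metric.ball x d, η z ∂μ := by
  -- Null balls and balls of negative radius, about which salience says nothing, contribute a zero
  -- integral.
  have hclosed : ∀ r < R, 0 ≤ s * ∫ z in Metric.closedBall x r, η z ∂μ := by
    intro r hr
    rcases (measureReal_nonneg : 0 ≤ μ.real (Metric.closedBall x r)).eq_or_lt with h0 | h0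
    · rw [Measure.restrict_eq_zero.2 ((measureReal_eq_zero_iff).1 h0.symm)]; simp
    · rcases lt_or_ge r 0 with hr0 | hr0
      · rw [Metric.closedBall_eq_empty.2 hr0] at h0; simp at h0
      have := h r hr0 hr h0
      rw [setBias, ← mul_div_assoc] at this
      exact ((div_pos_iff_of_pos_right h0).1 this).le
  -- An open ball is the increasing union of closed balls of smaller radii, all below R even when d
  -- = R. The limit keeps only a weak inequality, which suffices.
  have hmono : Monotone fun k : ℕ => Metric.closedBall x (d - 1 / ((k : ℝ) + 1)) := by
    intro i j hij
    apply Metric.closedBall_subset_closedBall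
    have := Nat.one_div_le_one_div (α := ℝ) hij
    linarith
  have hlim := tendsto_setIntegral_of_monotone (μ := μ) (f := η)
    (fun k : ℕ => (Metric.isClosed_closedBall.measurableSet : MeasurableSet
      (Metric.closedBall x (d - 1 / ((k : ℝ) + 1))))) hmono hη.integrableOn
  have hunion : ⋃ k : ℕ, Metric.closedBall x (d - 1 / ((k : ℝ) + 1)) = Metric.ball x d := by
    ext y
    simp only [Set.mem_iUnion, Metric.mem_closedBall, Metric.mem_ball]
    constructor
    · rintro ⟨k, hk⟩
      have : 0 < 1 / ((k : ℝ) + 1) := by positivity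
      linarith
    · intro hy
      obtain ⟨k, hk⟩ := exists_nat_one_div_lt (sub_pos.2 hy)
      exact ⟨k, by linarith⟩
  rw [hunion] at hlim
  refine ge_of_tendsto' (hlim.const_mul s) fun k => hclosed _ ?_
  have : 0 < 1 / ((k : ℝ) + 1) := by positivity
  linarith

end Population

/-! ### Empirical sums as indicator sums -/

section Indicator

theorem sum_indicesIn {𝒳 : Type*} {n : ℕ} (T : Fin n → 𝒳 × ℤˣ) (S : Set 𝒳) (f : 𝒳 × ℤˣ → ℝ) :
    ∑ j ∈ indicesIn T S, f (T j) = ∑ j, (Prod.fst ⁻¹' S).indicator f (T j) := by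
  classical
  simp only [indicesIn, Set.indicator_apply, Set.mem_preimage, Finset.sum_filter]

theorem cast_empCount {𝒳 : Type*} {n : ℕ} (T : Fin n → 𝒳 × ℤˣ) (S : Set 𝒳) :
    (empCount T S : ℝ) = ∑ j, (Prod.fst ⁻¹' S).indicator (fun _ => (1 : ℝ)) (T j) := by
  rw [← sum_indicesIn, empCount]; simp

end Indicator

/-! ### From salience to error probabilities -/

section Rates

variable {𝒳 : Type*} [MetricSpace 𝒳] [MeasurableSpace 𝒳] [BorelSpace 𝒳]

/-- Up to the radius `R`, balls around `x` have no bias against the label `g`, and the ball of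
radius `R` has bias at least `γ` towards `g`. -/
structure HasBiasedBall (P : Measure (𝒳 × ℤˣ)) (x : 𝒳) (g : ℤˣ) (R γ : ℝ) : Prop where
  radius_nonneg : 0 ≤ R
  pos : 0 < γ
  le_one : γ ≤ 1
  bias_le : γ * P.real (Prod.fst ⁻¹' Metric.closedBall x R) ≤
    ∫ z in Prod.fst ⁻¹' Metric.closedBall x R, labelVal g * labelVal z.2 ∂P
  nonneg : ∀ d ≤ R, 0 ≤ ∫ z in Prod.fst ⁻¹' Metric.ball x d, labelVal g * labelVal z.2 ∂P

/-- R is the probability radius, where the infimum is attained. The sign s must be the Bayes label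
because s η(x) > 0, and γ ≤ 1 because |η| ≤ 1. -/
theorem Salient.exists_hasBiasedBall {P : Measure (𝒳 × ℤˣ)} [IsProbabilityMeasure P] {η : 𝒳 → ℝ}
    (hη : IsBias P η) {gstar : 𝒳 → ℤˣ} (hg : IsBayesClassifier η gstar) {x : 𝒳} {p γ : ℝ}
    (h : Salient (marginal P) η x p γ) :
    ∃ R, HasBiasedBall P x (gstar x) R γ ∧
      p ≤ P.real (Prod.fst ⁻¹' Metric.closedBall x R) := by
  obtain ⟨⟨hp, -⟩, hγ, hne, s, hs, hsx, hpos, hR⟩ := h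
  have hs' : s = labelVal (gstar x) := by
    rcases hs with rfl | rfl
    · rw [(hg x).1 (by linarith)]; simp [labelVal]
    · rw [(hg x).2 (by linarith)]; simp [labelVal]
  have hq := le_measureReal_closedBall_probRadius (marginal P) x hne
  set R := probRadius (marginal P) x p with hRdef
  have hqpos : 0 < (marginal P).real (Metric.closedBall x R) := hp.trans_le hq
  have hclosed : MeasurableSet (Metric.closedBall x R) := Metric.isClosed_closedBall.measurableSet
  have hbias : γ * (marginal P).real (Metric.closedBall x R) ≤
      s * ∫ z in Metric.closedBall x R, η z ∂(marginal P) := by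
    rwa [setBias, ← mul_div_assoc, le_div_iff₀ hqpos] at hR
  have hup : s * ∫ z in Metric.closedBall x R, η z ∂(marginal P) ≤
      (marginal P).real (Metric.closedBall x R) := by
    have h1 : ‖∫ z in Metric.closedBall x R, η z ∂(marginal P)‖ ≤
        1 * (marginal P).real (Metric.closedBall x R) :=
      norm_setIntegral_le_of_norm_le_const (measure_lt_top _ _)
        fun z _ => abs_le.2 (hη.mem_Icc z)
    rw [Real.norm_eq_abs, one_mul, abs_le] at h1
    rcases hs with rfl | rfl <;> linarith
  refine ⟨R, ⟨Real.sInf_nonneg fun r hr => hr.1, hγ, ?_, ?_, fun d hd => ?_⟩, ?_⟩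
  · exact le_of_mul_le_mul_right ((hbias.trans hup).trans_eq (one_mul _).symm) hqpos
  · rw [integral_const_mul, hη.setIntegral_eq hclosed, ← marginal_real_apply P hclosed, ← hs']
    exact hbias
  · rw [integral_const_mul, hη.setIntegral_eq Metric.isOpen_ball.measurableSet, ← hs']
    exact setIntegral_ball_nonneg hη.integrable hpos hd
  · rwa [← marginal_real_apply P hclosed]

theorem Salient.mul_sq_le_one {P : Measure (𝒳 × ℤˣ)} [IsProbabilityMeasure P] {η : 𝒳 → ℝ}
    (hη : IsBias P η) {gstar : 𝒳 → ℤˣ} (hg : IsBayesClassifier η gstar) {x : 𝒳} {p γ : ℝ}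
    (h : Salient (marginal P) η x p γ) : p * γ ^ 2 ≤ 1 := by
  obtain ⟨R, hR, -⟩ := h.exists_hasBiasedBall hη hg
  exact mul_le_one₀ h.1.2 (sq_nonneg _) (pow_le_one₀ hR.pos.le hR.le_one)

theorem adv_le_one {P : Measure (𝒳 × ℤˣ)} [IsProbabilityMeasure P] {η : 𝒳 → ℝ}
    (hη : IsBias P η) {gstar : 𝒳 → ℤˣ} (hg : IsBayesClassifier η gstar) (x : 𝒳) :
    adv (marginal P) η x ≤ 1 := by
  rw [adv]
  split_ifs
  · exact zero_le_one
  · refine Real.sSup_le ?_ zero_le_one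
    rintro a ⟨p, γ, h, rfl⟩
    exact h.mul_sq_le_one hη hg

/-- The supremum need not be attained, hence the slack a. Positivity of the advantage excludes η(x)
= 0 and the empty supremum. -/
theorem exists_hasBiasedBall_of_lt_adv {P : Measure (𝒳 × ℤˣ)} [IsProbabilityMeasure P] {η : 𝒳 → ℝ}
    (hη : IsBias P η) {gstar : 𝒳 → ℤˣ} (hg : IsBayesClassifier η gstar) {x : 𝒳}
    (hadv : 0 < adv (marginal P) η x) {a : ℝ} (ha : a < adv (marginal P) η x) :
    ∃ R γ, HasBiasedBall P x (gstar x) R γ ∧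
      a < P.real (Prod.fst ⁻¹' Metric.closedBall x R) * γ ^ 2 := by
  have hx : η x ≠ 0 := by
    intro h; rw [adv, if_pos h] at hadv; exact lt_irrefl _ hadv
  rw [adv, if_neg hx] at hadv ha
  have hne : {a : ℝ | ∃ p γ : ℝ, Salient (marginal P) η x p γ ∧ a = p * γ ^ 2}.Nonempty := by
    by_contra h
    rw [Set.not_nonempty_iff_eq_empty.1 h, Real.sSup_empty] at hadv
    exact lt_irrefl _ hadv
  obtain ⟨_, ⟨p, γ, h, rfl⟩, hlt⟩ := exists_lt_of_lt_csSup hne ha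
  obtain ⟨R, hR, hp⟩ := h.exists_hasBiasedBall hη hg
  exact ⟨R, γ, hR, hlt.trans_le (mul_le_mul_of_nonneg_right hp (sq_nonneg _))⟩

/-- Only subadditivity is used, so the success event need not be shown measurable. -/
theorem one_sub_le_measureReal_of_compl_subset {Ω : Type*} [MeasurableSpace Ω] {Q : Measure Ω}
    [IsProbabilityMeasure Q] {G B : Set Ω} (h : Gᶜ ⊆ B) {e : ℝ} (hB : Q.real B ≤ e) :
    1 - e ≤ Q.real G := by
  have h1 : Q.real Set.univ ≤ Q.real (G ∪ B) := by
    refine measureReal_mono fun ω _ => ?_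
    by_cases hω : ω ∈ G
    · exact Or.inl hω
    · exact Or.inr (h hω)
  have h2 := measureReal_union_le (μ := Q) G B
  rw [probReal_univ] at h1
  linarith

theorem labelVal_mul_eq (g y : ℤˣ) : labelVal g * labelVal y = 1 ∨
    labelVal g * labelVal y = -1 := by
  rcases labelVal_eq g with h | h <;> rcases labelVal_eq y with h' | h' <;> simp [h, h']

theorem measurable_labelVal_mul {𝒳 : Type*} [MeasurableSpace 𝒳] (g : ℤˣ) :
    Measurable fun z : 𝒳 × ℤˣ => labelVal g * labelVal z.2 :=
  (measurable_labelVal.comp measurable_snd).const_mul _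

theorem measurableSet_fst_closedBall (x : 𝒳) (R : ℝ) :
    MeasurableSet ((Prod.fst : 𝒳 × ℤˣ → 𝒳) ⁻¹' Metric.closedBall x R) :=
  measurable_fst Metric.isClosed_closedBall.measurableSet

/-- A bound on the error probability through the concentration of the empirical biases. -/
theorem HasBiasedBall.one_sub_le_measureReal {P : Measure (𝒳 × ℤˣ)} [IsProbabilityMeasure P]
    {x : 𝒳} {g : ℤˣ} {R γ : ℝ} (h : HasBiasedBall P x g R γ) {c δ : ℝ} (hc : 0 ≤ c) {n : ℕ}
    (hb0 : 0 ≤ c ^ 2 * (Real.log n + Real.log (1 / δ)))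
    (hb : c ^ 2 * (Real.log n + Real.log (1 / δ)) ≤
      n * P.real (Prod.fst ⁻¹' Metric.closedBall x R) * γ ^ 2 / 16) :
    1 - (n * Real.exp (-(c ^ 2 * (Real.log n + Real.log (1 / δ))) / 2) +
      Real.exp (-(n * P.real (Prod.fst ⁻¹' Metric.closedBall x R) * γ ^ 2) / 10)) ≤
      (Measure.pi fun _ : Fin n => P).real {T | aknn c δ T x = some g} := by
  set b := c ^ 2 * (Real.log n + Real.log (1 / δ)) with hbdef
  set U := (Prod.fst : 𝒳 × ℤˣ → 𝒳) ⁻¹' Metric.closedBall x R with hU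
  set Y : 𝒳 × ℤˣ → ℝ := fun z => labelVal g * labelVal z.2 with hY
  let ρ : 𝒳 × ℤˣ → ℝ := fun z => dist z.1 x
  have hρ : Measurable ρ := (continuous_id.dist continuous_const).measurable.comp measurable_fst
  have hYm : Measurable Y := measurable_labelVal_mul g
  have hY1 : ∀ z, Y z = 1 ∨ Y z = -1 := fun z => labelVal_mul_eq g z.2
  set Q := Measure.pi fun _ : Fin n => P
  let B₀ : Set (Fin n → 𝒳 × ℤˣ) := {T | ∑ j, U.indicator Y (T j) ≤
    √(b * ∑ j, U.indicator (fun _ => (1 : ℝ)) (T j))}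
  let B : Fin n → Set (Fin n → 𝒳 × ℤˣ) := fun i => {T | ρ (T i) ≤ R ∧
    0 < ∑ j, {ω | ρ ω < ρ (T i)}.indicator (fun _ => (1 : ℝ)) (T j) ∧
      ∑ j, {ω | ρ ω < ρ (T i)}.indicator Y (T j) <
        -√(b * ∑ j, {ω | ρ ω < ρ (T i)}.indicator (fun _ => (1 : ℝ)) (T j))}
  refine one_sub_le_measureReal_of_compl_subset (B := (⋃ i, B i) ∪ B₀) ?_ ?_
  · intro T hT
    contrapose! hT
    simp only [Set.mem_union, Set.mem_iUnion, not_or, not_exists] at hT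
    obtain ⟨hB, hB₀⟩ := hT
    rw [Set.notMem_compl_iff]
    refine aknn_eq_some hc T x g h.radius_nonneg ?_ fun i hi hpos => ?_
    · rw [cast_empCount, sum_indicesIn T _ Y]
      exact not_le.1 hB₀
    · by_contra hlt
      refine hB i ⟨hi, ?_, ?_⟩
      · have : (0 : ℝ) < empCount T (Metric.ball x (dist (T i).1 x)) := by exact_mod_cast hpos
        rwa [cast_empCount] at this
      · rw [not_le, cast_empCount, sum_indicesIn T _ Y] at hlt
        exact hlt
  · have h1 : Q.real (⋃ i, B i) ≤ n * Real.exp (-b / 2) := by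
      refine (measureReal_iUnion_fintype_le _).trans ((Finset.sum_le_sum fun i _ =>
        measureReal_leaveOneOut_le P hρ hYm hY1 h.nonneg hb0 i).trans_eq ?_)
      simp
    have h2 : Q.real B₀ ≤ Real.exp (-(n * P.real U * γ ^ 2) / 10) := by
      have := measureReal_sum_indicator_le_sqrt_le (ι := Fin n) P
        (measurableSet_fst_closedBall x R) hYm hY1 h.pos h.le_one h.bias_le (b := b)
        (by rwa [Fintype.card_fin])
      rwa [Fintype.card_fin] at this
    exact (measureReal_union_le _ _).trans (add_le_add h1 h2)

/-- A bound on the error probability through the event that all sample points lie in the ball and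
have the correct label. -/
theorem HasBiasedBall.one_sub_mul_le_measureReal {P : Measure (𝒳 × ℤˣ)} [IsProbabilityMeasure P]
    {x : 𝒳} {g : ℤˣ} {R γ : ℝ} (h : HasBiasedBall P x g R γ) {c δ : ℝ} (hc : 0 ≤ c) {n : ℕ}
    (hn : 0 < n) (hb : c ^ 2 * (Real.log n + Real.log (1 / δ)) < n) :
    1 - n * (1 - P.real (Prod.fst ⁻¹' Metric.closedBall x R) * γ ^ 2) ≤
      (Measure.pi fun _ : Fin n => P).real {T | aknn c δ T x = some g} := by
  set U := (Prod.fst : 𝒳 × ℤˣ → 𝒳) ⁻¹' Metric.closedBall x R with hU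
  have hUm : MeasurableSet U := measurableSet_fst_closedBall x R
  set Y : 𝒳 × ℤˣ → ℝ := fun z => labelVal g * labelVal z.2 with hY
  have hYm : Measurable Y := measurable_labelVal_mul g
  have hY1 : ∀ z, Y z = 1 ∨ Y z = -1 := fun z => labelVal_mul_eq g z.2
  let V : Set (𝒳 × ℤˣ) := U ∩ {z | Y z = 1}
  have hV : MeasurableSet V := hUm.inter (hYm (measurableSet_singleton 1))
  have hPV : P.real Vᶜ ≤ 1 - P.real U * γ ^ 2 := by
    rw [probReal_compl_eq_one_sub hV]
    have h1 : ∫ z, U.indicator Y z ∂P ≤ ∫ z, V.indicator (fun _ => (1 : ℝ)) z ∂P := by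
      refine integral_mono ((integrable_of_abs_le P hYm 1 fun z =>
        (abs_eq_one_of_sign (hY1 z)).le).indicator hUm) ((integrable_const _).indicator hV) ?_
      intro z
      by_cases hz : z ∈ U
      · rcases hY1 z with hz' | hz'
        · simp [V, hz, hz']
        · rw [Set.indicator_of_mem hz, hz']
          exact (by norm_num : (-1 : ℝ) ≤ 0).trans
            (Set.indicator_nonneg (fun _ _ => zero_le_one) _)
      · simp [V, hz]
    rw [integral_indicator hUm, integral_indicator hV, setIntegral_const, smul_eq_mul,
      mul_one] at h1
    have h2 := h.bias_le
    -- The mass of V is at least the integral of Y over U, hence at least γ q, and γ q ≥ γ² q as γ ≤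
    -- 1.
    have h3 : P.real U * γ ^ 2 ≤ γ * P.real U := by
      have := mul_le_mul_of_nonneg_left h.le_one
        (mul_nonneg h.pos.le (measureReal_nonneg : 0 ≤ P.real U))
      nlinarith
    linarith
  refine one_sub_le_measureReal_of_compl_subset
    (B := ⋃ i, (fun T : Fin n → 𝒳 × ℤˣ => T i) ⁻¹' Vᶜ) ?_ ?_
  · intro T hT
    contrapose! hT
    simp only [Set.mem_iUnion, not_exists, Set.mem_preimage, Set.notMem_compl_iff] at hT
    rw [Set.notMem_compl_iff]
    have hsum : ∀ S : Set 𝒳, ∑ i ∈ indicesIn T S, labelVal g * labelVal (T i).2 =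
        empCount T S := by
      intro S
      rw [Finset.sum_congr rfl fun i _ => (hT i).2]
      simp [empCount]
    have hall : indicesIn T (Metric.closedBall x R) = Finset.univ :=
      Finset.eq_univ_of_forall fun i => mem_indicesIn.2 (hT i).1
    refine aknn_eq_some hc T x g h.radius_nonneg ?_ fun i _ _ => ?_
    · rw [hsum, empCount, hall, Finset.card_univ, Fintype.card_fin]
      have hn' : (0 : ℝ) < n := by exact_mod_cast hn
      rw [Real.sqrt_lt' hn', sq (n : ℝ)]
      exact mul_lt_mul_of_pos_right hb hn'
    · rw [hsum]
      exact (neg_nonpos.2 (Real.sqrt_nonneg _)).trans (Nat.cast_nonneg _)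
  · refine (measureReal_iUnion_fintype_le _).trans ((Finset.sum_le_sum fun i _ => ?_).trans_eq
      (?_ : ∑ _i : Fin n, (1 - P.real U * γ ^ 2) = _))
    · rw [measureReal_def, (measurePreserving_eval (fun _ : Fin n => P) i).measure_preimage
        hV.compl.nullMeasurableSet]
      exact hPV
    · rw [Finset.sum_const, Finset.card_univ, Fintype.card_fin, nsmul_eq_mul]

/-! ### Large and small samples -/

theorem log_le_div_add {y z : ℝ} (hy : 0 < y) (hz : 0 < z) : Real.log y ≤ y / z + z := by
  have h1 := Real.log_le_sub_one_of_pos (div_pos hy hz)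
  have h2 := Real.log_le_sub_one_of_pos hz
  rw [Real.log_div hy.ne' hz.ne'] at h1
  linarith

/-- The error bound when `n * A` is large, where `A` is at most twice the advantage of the ball. -/
theorem HasBiasedBall.one_sub_le_of_large {P : Measure (𝒳 × ℤˣ)} [IsProbabilityMeasure P]
    {x : 𝒳} {g : ℤˣ} {R γ : ℝ} (h : HasBiasedBall P x g R γ) {c δ A : ℝ} (hc : 0 ≤ c)
    (hc2 : 5 / 2 ≤ c ^ 2) (hδ : 0 < δ) (hδ1 : δ < 1) (hA : 0 < A) (hA1 : A ≤ 1) {n : ℕ}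
    (hw : A / 2 ≤ P.real (Prod.fst ⁻¹' Metric.closedBall x R) * γ ^ 2)
    (h1 : 256 * c ^ 2 * Real.log (1 / A) ≤ n * A) (h2 : 256 * c ^ 2 * Real.log (1 / δ) ≤ n * A)
    (h3 : (128 * c ^ 2) ^ 2 ≤ n * A) :
    1 - δ ≤ (Measure.pi fun _ : Fin n => P).real {T | aknn c δ T x = some g} := by
  set w := P.real (Prod.fst ⁻¹' Metric.closedBall x R) * γ ^ 2 with hwdef
  have hu : (102400 : ℝ) ≤ n * A := by
    refine le_trans ?_ h3
    nlinarith
  have hn0 : (0 : ℝ) ≤ n := Nat.cast_nonneg n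
  have hnA : (n : ℝ) * A ≤ n := mul_le_of_le_one_right hn0 hA1
  have hn : (16 : ℝ) ≤ n := by linarith
  have hℓ : 0 < Real.log (1 / δ) := Real.log_pos (by rwa [lt_div_iff₀ hδ, one_mul])
  have hlogn : Real.log n = Real.log (n * A) + Real.log (1 / A) := by
    rw [Real.log_mul (by linarith) hA.ne', one_div, Real.log_inv]; ring
  have hlogn16 : 4 * Real.log 2 ≤ Real.log n := by
    rw [show 4 * Real.log 2 = Real.log 16 by
      rw [show (16 : ℝ) = 2 ^ 4 by norm_num, Real.log_pow]; norm_num]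
    exact Real.log_le_log (by norm_num) hn
  have hlog2 : 0 < Real.log 2 := Real.log_pos (by norm_num)
  have hlog2' : Real.log 2 ≤ 1 := by
    have := Real.log_two_lt_d9; linarith
  -- With z = 128 c² the error terms are nA/128 and 128 c⁴; the latter is at most nA/128 by `h3`.
  have hlogu : c ^ 2 * Real.log (n * A) ≤ n * A / 128 + n * A / 128 := by
    have := mul_le_mul_of_nonneg_left (log_le_div_add (by linarith : 0 < (n : ℝ) * A)
      (by linarith : 0 < 128 * c ^ 2)) (by linarith : 0 ≤ c ^ 2)
    have e : c ^ 2 * (n * A / (128 * c ^ 2)) = n * A / 128 := by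
      have : c ^ 2 ≠ 0 := by linarith
      generalize c ^ 2 = y at *
      field_simp
    rw [mul_add, e] at this
    nlinarith
  set b := c ^ 2 * (Real.log n + Real.log (1 / δ)) with hb
  -- 1/64 from log(nA), and 1/256 from each of log(1/A) and log(1/δ).
  have hble : b ≤ n * A / 32 := by
    rw [hb, hlogn]; nlinarith
  have hb1 : 5 / 2 * (Real.log n + Real.log (1 / δ)) ≤ b :=
    mul_le_mul_of_nonneg_right hc2 (by linarith)
  have hnw : n * A / 2 ≤ n * w := by
    have := mul_le_mul_of_nonneg_left hw hn0; linarith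
  refine le_trans ?_ (h.one_sub_le_measureReal hc (δ := δ) (n := n) (by rw [← hb]; linarith)
    (by rw [← hb, mul_assoc, ← hwdef]; linarith))
  rw [← hb, mul_assoc (n : ℝ), ← hwdef]
  have hδ2 : δ / 2 = Real.exp (-Real.log (1 / δ) - Real.log 2) := by
    rw [Real.exp_sub, Real.exp_log (by norm_num), one_div, Real.log_inv, neg_neg, Real.exp_log hδ]
  -- Since b/2 ≥ (5/4)(log n + log(1/δ)), the left side is at most n^(-1/4) δ^(5/4), and n ≥ 16
  -- makes the first factor at most 1/2.
  have e1 : n * Real.exp (-b / 2) ≤ δ / 2 := by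
    rw [hδ2]
    nth_rewrite 1 [← Real.exp_log (by linarith : (0 : ℝ) < n)]
    rw [← Real.exp_add, Real.exp_le_exp]
    linarith
  have e2 : Real.exp (-(n * w) / 10) ≤ δ / 2 := by
    rw [hδ2, Real.exp_le_exp]
    have : 640 * Real.log (1 / δ) ≤ 256 * c ^ 2 * Real.log (1 / δ) :=
      mul_le_mul_of_nonneg_right (by linarith) hℓ.le
    linarith
  linarith

/-- The error bound for a small sample and an advantage close to one. -/
theorem HasBiasedBall.one_sub_le_of_small {P : Measure (𝒳 × ℤˣ)} [IsProbabilityMeasure P]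
    {x : 𝒳} {g : ℤˣ} {R γ : ℝ} (h : HasBiasedBall P x g R γ) {δ : ℝ}
    (hδ : 0 < δ) {n : ℕ} (hn : 0 < n)
    (hw : n * (1 - P.real (Prod.fst ⁻¹' Metric.closedBall x R) * γ ^ 2) ≤ 1 / 4)
    (h1 : Real.log (1 / δ) ≤ 3 / 4) (h2 : Real.log (1 / δ) ≤ n / 100) :
    1 - δ ≤ (Measure.pi fun _ : Fin n => P).real {T | aknn √(5 / 2) δ T x = some g} := by
  have hn' : (0 : ℝ) < n := by exact_mod_cast hn
  have hsq : √(5 / 2 : ℝ) ^ 2 = 5 / 2 := Real.sq_sqrt (by norm_num)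
  -- This is log n ≤ n/e; as 5/2 < e, it leaves room for log(1/δ) in b < n.
  have hlog : Real.log n ≤ n / 2.7182818283 := by
    have := Real.log_le_sub_one_of_pos (div_pos hn' (Real.exp_pos 1))
    rw [Real.log_div hn'.ne' (Real.exp_pos 1).ne', Real.log_exp] at this
    have h3 : (n : ℝ) / Real.exp 1 ≤ n / 2.7182818283 :=
      div_le_div_of_nonneg_left hn'.le (by norm_num) Real.exp_one_gt_d9.le
    linarith
  refine le_trans ?_ (h.one_sub_mul_le_measureReal (Real.sqrt_nonneg _) (δ := δ) hn ?_)
  -- log(1/δ) ≤ 3/4 forces δ ≥ 1/4, which covers the failure probability.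
  · have h4 := Real.log_le_sub_one_of_pos hδ
    rw [one_div, Real.log_inv] at h1
    linarith
  · rw [hsq]
    have : (n : ℝ) / 2.7182818283 ≤ n * (3679 / 10000) := by
      rw [div_le_iff₀ (by norm_num)]
      nlinarith
    linarith

end Rates

end AKNN

/-! ### Choice of constants -/

theorem theorem1 :
    ∃ c₀ : ℝ, 0 < c₀ ∧
      -- the algorithm run with the constant `c₀` in the confidence width
      (∃ C : ℝ, 0 < C ∧
        ∀ (𝒳 : Type*) [MetricSpace 𝒳] [TopologicalSpace.SeparableSpace 𝒳]
          [MeasurableSpace 𝒳] [BorelSpace 𝒳]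
          (P : Measure (𝒳 × ℤˣ)) [IsProbabilityMeasure P]
          (η : 𝒳 → ℝ) (_ : AKNN.IsBias P η)
          (gstar : 𝒳 → ℤˣ) (_ : AKNN.IsBayesClassifier η gstar)
          (δ : ℝ) (_ : 0 < δ) (_ : δ < 1) (n : ℕ)
          (x : 𝒳) (_ : x ∈ (AKNN.marginal P).support)
          (_ : 0 < AKNN.adv (AKNN.marginal P) η x)
          (_ : C / AKNN.adv (AKNN.marginal P) η x *
              max (Real.log (1 / AKNN.adv (AKNN.marginal P) η x)) (Real.log (1 / δ)) ≤ (n : ℝ)),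
          1 - δ ≤ (Measure.pi fun _ : Fin n => P).real
            {T | AKNN.aknn c₀ δ T x = some (gstar x)}) ∧
      -- the algorithm run with any larger constant `c₁` in the confidence width
      (∀ c₁ : ℝ, c₀ ≤ c₁ → ∃ C : ℝ, 0 < C ∧
        ∀ (𝒳 : Type*) [MetricSpace 𝒳] [TopologicalSpace.SeparableSpace 𝒳]
          [MeasurableSpace 𝒳] [BorelSpace 𝒳]
          (P : Measure (𝒳 × ℤˣ)) [IsProbabilityMeasure P]
          (η : 𝒳 → ℝ) (_ : AKNN.IsBias P η)
          (gstar : 𝒳 → ℤˣ) (_ : AKNN.IsBayesClassifier η gstar)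
          (δ : ℝ) (_ : 0 < δ) (_ : δ < 1) (n : ℕ)
          (x : 𝒳) (_ : x ∈ (AKNN.marginal P).support)
          (_ : 0 < AKNN.adv (AKNN.marginal P) η x)
          (_ : C / AKNN.adv (AKNN.marginal P) η x *
              max (Real.log (2 / AKNN.adv (AKNN.marginal P) η x)) (Real.log (1 / δ)) ≤ (n : ℝ)),
          1 - δ ≤ (Measure.pi fun _ : Fin n => P).real
            {T | AKNN.aknn c₁ δ T x = some (gstar x)}) := by
  have hsq : √(5 / 2 : ℝ) ^ 2 = 5 / 2 := Real.sq_sqrt (by norm_num)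
  -- 102400 = (128 · 5/2)² is the threshold for nA in the large-sample bound. The further factor 16
  -- · 102400 in C makes 1 - A tiny below that threshold.
  refine ⟨√(5 / 2), by positivity, ⟨16 * 102400 ^ 2, by norm_num, ?_⟩, fun c₁ hc₁ => ?_⟩
  · intro 𝒳 _ _ _ _ P _ η hη gstar hg δ hδ hδ1 n x _ hadv hn
    have hA1 := AKNN.adv_le_one hη hg x
    obtain ⟨R, γ, hball, hw⟩ := AKNN.exists_hasBiasedBall_of_lt_adv hη hg hadv
      (a := (1 - 1 / (16 * 102400)) * AKNN.adv (AKNN.marginal P) η x) (by linarith)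
    set A := AKNN.adv (AKNN.marginal P) η x
    have hℓ : 0 < Real.log (1 / δ) := Real.log_pos (by rwa [lt_div_iff₀ hδ, one_mul])
    have hn0 : (0 : ℝ) ≤ n := Nat.cast_nonneg n
    have hnA : (n : ℝ) * A ≤ n := mul_le_of_le_one_right hn0 hA1
    rw [div_mul_eq_mul_div, div_le_iff₀ hadv] at hn
    have h1 := (mul_le_mul_of_nonneg_left (le_max_left (Real.log (1 / A)) (Real.log (1 / δ)))
      (by norm_num : (0 : ℝ) ≤ 16 * 102400 ^ 2)).trans hn
    have h2 := (mul_le_mul_of_nonneg_left (le_max_right (Real.log (1 / A)) (Real.log (1 / δ)))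
      (by norm_num : (0 : ℝ) ≤ 16 * 102400 ^ 2)).trans hn
    have hlogA : 1 - A ≤ Real.log (1 / A) := by
      have := Real.log_le_sub_one_of_pos hadv
      rw [one_div, Real.log_inv]; linarith
    rcases le_or_gt 102400 ((n : ℝ) * A) with hu | hu
    · refine hball.one_sub_le_of_large (Real.sqrt_nonneg _) hsq.ge hδ hδ1 hadv hA1 (by linarith)
        ?_ ?_ ?_
      · rw [hsq]; linarith
      · rw [hsq]; linarith
      · rw [hsq]; linarith
    -- Here 1 - A ≤ log(1/A) ≤ nA/C, so A is near 1, n is bounded by twice the threshold, and the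
    -- slack chosen in a keeps n(1 - w) ≤ 1/4.
    · have hA2 : 1 - A ≤ 1 / (16 * 102400) := by linarith
      have hn2 : (n : ℝ) ≤ 2 * 102400 := by nlinarith
      have hnpos : 0 < n := by
        rw [← Nat.cast_pos (α := ℝ)]; linarith
      refine hball.one_sub_le_of_small hδ hnpos ?_ (by linarith) (by linarith)
      set w := P.real (Prod.fst ⁻¹' Metric.closedBall x R) * γ ^ 2
      have hw2 : 1 - w ≤ 1 / (8 * 102400) := by linarith
      have := mul_le_mul_of_nonneg_left hw2 hn0
      linarith
  · have hc0 : 0 ≤ c₁ := (Real.sqrt_nonneg _).trans hc₁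
    have hc2 : 5 / 2 ≤ c₁ ^ 2 := hsq ▸ pow_le_pow_left₀ (Real.sqrt_nonneg _) hc₁ 2
    -- The first summand handles the logarithms; the second, with log 2 ≥ 1/2, gives nA ≥ (128
    -- c₁²)².
    refine ⟨256 * c₁ ^ 2 + 2 * (128 * c₁ ^ 2) ^ 2, by positivity, ?_⟩
    intro 𝒳 _ _ _ _ P _ η hη gstar hg δ hδ hδ1 n x _ hadv hn
    have hA1 := AKNN.adv_le_one hη hg x
    obtain ⟨R, γ, hball, hw⟩ := AKNN.exists_hasBiasedBall_of_lt_adv hη hg hadv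
      (a := AKNN.adv (AKNN.marginal P) η x / 2) (by linarith)
    set A := AKNN.adv (AKNN.marginal P) η x
    have hℓ : 0 < Real.log (1 / δ) := Real.log_pos (by rwa [lt_div_iff₀ hδ, one_mul])
    rw [div_mul_eq_mul_div, div_le_iff₀ hadv] at hn
    have hC : 0 ≤ 256 * c₁ ^ 2 + 2 * (128 * c₁ ^ 2) ^ 2 := by positivity
    have h1 := (mul_le_mul_of_nonneg_left (le_max_left (Real.log (2 / A)) (Real.log (1 / δ)))
      hC).trans hn
    have h2 := (mul_le_mul_of_nonneg_left (le_max_right (Real.log (2 / A)) (Real.log (1 / δ)))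
      hC).trans hn
    have hlogA : 0 ≤ Real.log (1 / A) := Real.log_nonneg (by rwa [le_div_iff₀ hadv, one_mul])
    have hlog2 : Real.log (2 / A) = Real.log 2 + Real.log (1 / A) := by
      rw [one_div, Real.log_inv, Real.log_div two_ne_zero hadv.ne']; ring
    have hhalf : 1 / 2 ≤ Real.log 2 := by
      have := Real.log_two_gt_d9; linarith
    have hD : 0 ≤ (128 * c₁ ^ 2) ^ 2 := sq_nonneg _
    rw [hlog2] at h1
    refine hball.one_sub_le_of_large hc0 hc2 hδ hδ1 hadv hA1 hw.le ?_ ?_ ?_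
    · nlinarith [mul_nonneg hD hlogA]
    · nlinarith [mul_nonneg hD hℓ.le]
    · nlinarith [mul_nonneg hD hlogA, mul_nonneg (sq_nonneg c₁) hlogA,
        mul_le_mul_of_nonneg_left hhalf hD]
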